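/- Let $\mathbb{R}_{\max}=\mathbb{R}\cup\{-\infty\}$ with the tropical operations $a\oplus b=\max(a,b)$ and $a\otimes b=a+b$ (where $-\infty$ is absorbing for $\otimes$), and for $a,x\in\mathbb{R}_{\max}^n$ put $a^Tx=\max_{1\le i\le n}(a_i+x_i)$. A tropical polyhedron in $\mathbb{R}_{\max}^n$ is an intersection of finitely many sets of the form $\{x\in\mathbb{R}_{\max}^n : a^Tx\oplus\alpha\le b^Tx\oplus\beta\}$ with $a,b\in\mathbb{R}_{\max}^n$ and $\alpha,\beta\in\mathbb{R}_{\max}$. Let $\operatorname{TP}\subseteq\mathbb{R}_{\max}^n$ be a non-empty tropical polyhedron, and let $\mathcal{M}(\operatorname{TP})$ be the set of its minimal points, that is, of those $x\in\operatorname{TP}$ such that $y\in\operatorname{TP}$ and $y\le x$ (coordinatewise) imply $y=x$. Then $\mathcal{M}(\operatorname{TP})$ is finite and non-empty, and it is a min-essential subset of $\operatorname{TP}$: for every $x\in\mathbb{R}_{\max}^n$ the minimum $\min\{x^Tz : z\in\operatorname{TP}\}$ exists and is attained at a point of $\mathcal{M}(\operatorname{TP})$. -/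

import Mathlib

/-- The max-plus semiring `ℝ ∪ {-∞}`: `⊥` is `-∞`, tropical addition is `⊔`,
tropical multiplication is `+` (with `⊥ + a = a + ⊥ = ⊥`). -/
abbrev Rmax : Type := WithBot ℝ

/-- The tropical scalar product `aᵀx = max_i (a_i + x_i)`; it is `⊥` when `n = 0`. -/
noncomputable def tropicalDot {n : ℕ} (a x : Fin n → Rmax) : Rmax :=
  Finset.univ.sup fun i => a i + x i

/-- The tropical affine halfspace `{x | aᵀx ⊕ α ≤ bᵀx ⊕ β}`. -/
def tropicalHalfspace {n : ℕ} (a b : Fin n → Rmax) (α β : Rmax) : Set (Fin n → Rmax) :=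
  {x | tropicalDot a x ⊔ α ≤ tropicalDot b x ⊔ β}

/-- A tropical polyhedron: an intersection of finitely many tropical affine halfspaces. -/
def IsTropicalPolyhedron {n : ℕ} (P : Set (Fin n → Rmax)) : Prop :=
  ∃ H : Set (Set (Fin n → Rmax)), H.Finite ∧
    (∀ h ∈ H, ∃ (a b : Fin n → Rmax) (α β : Rmax), h = tropicalHalfspace a b α β) ∧
    P = ⋂₀ H

/-- The set of minimal points of `P` in the coordinatewise order. -/
def minimalPoints {n : ℕ} (P : Set (Fin n → Rmax)) : Set (Fin n → Rmax) :=
  {x | x ∈ P ∧ ∀ y ∈ P, y ≤ x → y = x}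

/-- `S` is a min-essential subset of `P`: for every `x`, the minimum of `xᵀz` over `z ∈ P`
exists and is attained at a point of `S`. -/
def IsMinEssential {n : ℕ} (S P : Set (Fin n → Rmax)) : Prop :=
  S ⊆ P ∧ ∀ x : Fin n → Rmax, ∃ z ∈ S, IsMinOn (fun w => tropicalDot x w) P z

/-! Since `z ↦ xᵀz` is monotone, it suffices that every point lies above a minimal one and that
minimal points are finite in number. Existence is Zorn's lemma: infima of chains stay in the
polyhedron (`exists_isGLB_mem_homogeneousSolutions`). For finiteness, let `T` be a set of
coordinates containing the homogenizing one. At a minimal point, lowering the finite coordinates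
outside `T` slightly must break an inequality, which ties some coordinate outside `T` to one inside
by a coefficient difference (`exists_eq_add_of_minimal`). Enlarging `T` reaches every coordinate
within `n` steps, leaving finitely many values. -/

/-- The homogenized coordinates of a point: the extra coordinate `none` carries the constant. -/
def homogenize {n : ℕ} (c : Rmax) (x : Fin n → Rmax) : Option (Fin n) → Rmax :=
  fun o => o.elim c x

/-- The points satisfying a family of homogenized inequalities `max_j (a_j + x_j) ≤ max_i (b_i + x_i)`. -/
def homogeneousSolutions {n : ℕ}
    (K : Set ((Option (Fin n) → Rmax) × (Option (Fin n) → Rmax))) : Set (Fin n → Rmax) :=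
  {x | ∀ k ∈ K, ∀ j, ∃ i, k.1 j + homogenize 0 x j ≤ k.2 i + homogenize 0 x i}

theorem mem_tropicalHalfspace_iff {n : ℕ} (a b x : Fin n → Rmax) (α β : Rmax) :
    x ∈ tropicalHalfspace a b α β ↔ ∀ j, ∃ i,
      homogenize α a j + homogenize 0 x j ≤ homogenize β b i + homogenize 0 x i := by
  have key : ∀ c : Rmax, c ≤ tropicalDot b x ⊔ β ↔
      ∃ i, c ≤ homogenize β b i + homogenize 0 x i := by
    intro c
    by_cases hc : c = ⊥
    · simp [hc]
    · rw [Option.exists]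
      simp only [homogenize, Option.elim, add_zero]
      rw [le_sup_iff, or_comm, tropicalDot, Finset.le_sup_iff (bot_lt_iff_ne_bot.2 hc)]
      simp
  rw [tropicalHalfspace, Set.mem_ofPred_eq, sup_le_iff, Option.forall, and_comm, key α]
  refine and_congr (by simp only [homogenize, Option.elim, add_zero]) ?_
  rw [tropicalDot, Finset.sup_le_iff]
  simp only [Finset.mem_univ, true_imp_iff]
  exact forall_congr' fun j => key _

theorem IsTropicalPolyhedron.exists_homogeneousSolutions {n : ℕ} {P : Set (Fin n → Rmax)}
    (hP : IsTropicalPolyhedron P) :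
    ∃ K : Set ((Option (Fin n) → Rmax) × (Option (Fin n) → Rmax)),
      K.Finite ∧ P = homogeneousSolutions K := by
  obtain ⟨H, hfin, hH, rfl⟩ := hP
  choose! a b α β h using hH
  refine ⟨(fun h => (homogenize (α h) (a h), homogenize (β h) (b h))) '' H, hfin.image _, ?_⟩
  ext x
  simp only [Set.mem_sInter, homogeneousSolutions, Set.forall_mem_image, Set.mem_ofPred_eq]
  refine forall₂_congr fun s hs => ?_
  conv_lhs => rw [h s hs]
  exact mem_tropicalHalfspace_iff _ _ _ _ _

/-! ### Existence of minimal points -/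

theorem Rmax.le_add_of_isGLB {S : Set Rmax} {m b L : Rmax} (hS : S.Nonempty) (hm : IsGLB S m)
    (h : ∀ s ∈ S, L ≤ b + s) : L ≤ b + m := by
  induction b using WithBot.recBotCoe with
  | bot =>
    obtain ⟨s, hs⟩ := hS
    simpa using h s hs
  | coe b =>
    induction L using WithBot.recBotCoe with
    | bot => exact bot_le
    | coe l =>
      have hle : ((l - b : ℝ) : Rmax) ≤ m := hm.2 fun s hs => by
        have := h s hs
        induction s using WithBot.recBotCoe with
        | bot => simp at this
        | coe s =>
          norm_cast at this ⊢
          linarith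
      induction m using WithBot.recBotCoe with
      | bot => simp at hle
      | coe m =>
        norm_cast at hle ⊢
        linarith

theorem homogenize_mono {n : ℕ} (c : Rmax) {x y : Fin n → Rmax} (h : x ≤ y) :
    homogenize c x ≤ homogenize c y := by
  rintro (_ | i)
  exacts [le_rfl, h i]

/-- An inequality failing at the infimum has, for each of its finitely many right-hand terms, a
chain element where that term is already too small. A chain element below all of these violates the
inequality. -/
theorem exists_isGLB_mem_homogeneousSolutions {n : ℕ}
    {K : Set ((Option (Fin n) → Rmax) × (Option (Fin n) → Rmax))} {C : Set (Fin n → Rmax)}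
    (hC : C ⊆ homogeneousSolutions K) (hchain : IsChain (· ≤ ·) C) (hne : C.Nonempty) :
    ∃ y ∈ homogeneousSolutions K, IsGLB C y := by
  have hglb : ∀ i, IsGLB (Function.eval i '' C) (sInf (Function.eval i '' C)) := fun i =>
    isGLB_csInf (hne.image _) (OrderBot.bddBelow _)
  have hC' : IsGLB C fun i => sInf (Function.eval i '' C) := isGLB_pi.2 hglb
  refine ⟨_, ?_, hC'⟩
  set y : Fin n → Rmax := fun i => sInf (Function.eval i '' C)
  intro k hk j
  by_contra! hlt
  have hex : ∀ i, ∃ c : C, k.2 i + homogenize 0 c.1 i < k.1 j + homogenize 0 y j := by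
    intro i
    by_contra! hle
    refine (hlt i).not_ge ?_
    cases i with
    | none => exact hle ⟨_, hne.choose_spec⟩
    | some i =>
      refine Rmax.le_add_of_isGLB (hne.image _) (hglb i) ?_
      rintro _ ⟨c, hc, rfl⟩
      exact hle ⟨c, hc⟩
  choose g hg using hex
  have : Nonempty C := hne.to_subtype
  have hdir : Directed (· ≥ ·) (Subtype.val : C → Fin n → Rmax) := fun c d =>
    (hchain.total c.2 d.2).elim (fun h => ⟨c, le_rfl, h⟩) fun h => ⟨d, h, le_rfl⟩
  obtain ⟨z, hz⟩ := hdir.finite_le g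
  obtain ⟨i, hi⟩ := hC z.2 k hk j
  refine absurd (hg i) (not_lt.2 ?_)
  calc k.1 j + homogenize 0 y j ≤ k.1 j + homogenize 0 z.1 j := by
        gcongr; exact homogenize_mono 0 (hC'.1 z.2) j
    _ ≤ _ := hi
    _ ≤ _ := by gcongr; exact homogenize_mono 0 (hz i) i

theorem exists_minimalPoints_le {n : ℕ} {P : Set (Fin n → Rmax)} (hP : IsTropicalPolyhedron P)
    {x : Fin n → Rmax} (hx : x ∈ P) : ∃ m ∈ minimalPoints P, m ≤ x := by
  obtain ⟨K, -, rfl⟩ := hP.exists_homogeneousSolutions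
  obtain ⟨m, hm, hmin⟩ := @zorn_le_nonempty₀ (Fin n → Rmax)ᵒᵈ _ (homogeneousSolutions K)
    (fun c hc hchain y hy => by
      obtain ⟨z, hz, hglb⟩ := exists_isGLB_mem_homogeneousSolutions hc hchain.symm ⟨y, hy⟩
      exact ⟨z, hz, fun w hw => hglb.1 hw⟩) x hx
  exact ⟨m, ⟨hmin.1, fun y hy hle => le_antisymm hle (hmin.2 hy hle)⟩, hm⟩

/-! ### Finiteness of the set of minimal points -/

theorem Set.Finite.exists_pos_le_of_pos {G : Set ℝ} (hG : G.Finite) :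
    ∃ ε > 0, ∀ g ∈ G, 0 < g → ε ≤ g := by
  have hfin : (insert 1 {g ∈ G | 0 < g}).Finite := (hG.subset (Set.sep_subset _ _)).insert 1
  obtain ⟨ε, hε, hmin⟩ := Set.exists_min_image _ id hfin ⟨1, Set.mem_insert _ _⟩
  refine ⟨ε, ?_, fun g hg h0 => hmin g (Set.mem_insert_of_mem _ ⟨hg, h0⟩)⟩
  rcases hε with rfl | hε
  exacts [one_pos, hε.2]

/-- The differences between a right-hand and a left-hand coefficient of the same inequality. -/
def coefficientDifferences {n : ℕ}
    (K : Set ((Option (Fin n) → Rmax) × (Option (Fin n) → Rmax))) : Set ℝ :=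
  ⋃ k ∈ K, Set.range fun p : Option (Fin n) × Option (Fin n) =>
    (k.1 p.2).unbotD 0 - (k.2 p.1).unbotD 0

theorem finite_coefficientDifferences {n : ℕ}
    {K : Set ((Option (Fin n) → Rmax) × (Option (Fin n) → Rmax))} (hK : K.Finite) :
    (coefficientDifferences K).Finite :=
  hK.biUnion fun _ _ => Set.finite_range _

theorem exists_eq_add_of_minimal {n : ℕ}
    {K : Set ((Option (Fin n) → Rmax) × (Option (Fin n) → Rmax))} (hK : K.Finite)
    {x : Fin n → Rmax} (hx : x ∈ minimalPoints (homogeneousSolutions K))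
    {T : Set (Option (Fin n))} (hT : none ∈ T)
    (hne : ∃ i, some i ∉ T ∧ x i ≠ ⊥) :
    ∃ i ∉ T, ∃ j ∈ T, ∃ d ∈ coefficientDifferences K,
      homogenize 0 x i = (d : Rmax) + homogenize 0 x j := by
  classical
  set u : Option (Fin n) → ℝ := fun o => (homogenize 0 x o).unbotD 0 with hu
  -- `ε` is at most every positive slack `x_i - x_j - d`, so a term that falls short after lowering
  -- by `ε` had slack zero.
  obtain ⟨ε, hε, hgap⟩ := Set.Finite.exists_pos_le_of_pos
    ((finite_coefficientDifferences hK).image2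
      (fun d (p : Option (Fin n) × Option (Fin n)) => u p.1 - u p.2 - d) Set.finite_univ)
  let y : Fin n → Rmax := fun i => if some i ∈ T then x i else x i + ((-ε : ℝ) : Rmax)
  have hsub : ∀ r : Rmax, r + ((-ε : ℝ) : Rmax) ≤ r := by
    intro r
    induction r using WithBot.recBotCoe with
    | bot => simp
    | coe r => norm_cast; linarith
  have hyT : ∀ o ∈ T, homogenize 0 y o = homogenize 0 x o := by
    rintro (_ | i) h
    · rfl
    · simp [homogenize, y, h]
  have hyS : ∀ o ∉ T, homogenize 0 y o = homogenize 0 x o + ((-ε : ℝ) : Rmax) := by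
    rintro (_ | i) h
    · exact absurd hT h
    · simp [homogenize, y, h]
  have hyge : ∀ o, homogenize 0 x o + ((-ε : ℝ) : Rmax) ≤ homogenize 0 y o := by
    intro o
    by_cases h : o ∈ T
    · exact (hsub _).trans (hyT o h).ge
    · exact (hyS o h).ge
  have hyx : y ≤ x := by
    intro i
    by_cases h : some i ∈ T
    · simp [y, h]
    · simpa [y, h] using hsub (x i)
  have hynot : y ∉ homogeneousSolutions K := by
    intro hy
    obtain ⟨i, hi, hbot⟩ := hne
    have := congrFun (hx.2 y hy hyx) i
    simp only [y, hi, if_false] at this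
    obtain ⟨r, hr⟩ := WithBot.ne_bot_iff_exists.1 hbot
    rw [← hr] at this
    norm_cast at this
    linarith
  simp only [homogeneousSolutions, Set.mem_ofPred_eq, not_forall, not_exists, not_le] at hynot
  obtain ⟨k, hk, j, hlt⟩ := hynot
  obtain ⟨i, hi⟩ := hx.1 k hk j
  have hlt := hlt i
  -- For `j ∉ T` the left side drops by exactly `ε` and the right side by at most `ε`, so the
  -- inequality would survive.
  have hj : j ∈ T := by
    by_contra hj
    refine hlt.not_ge ?_
    rw [hyS j hj, ← add_assoc]
    calc _ ≤ k.2 i + homogenize 0 x i + ((-ε : ℝ) : Rmax) := by gcongr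
      _ ≤ _ := by rw [add_assoc]; gcongr; exact hyge i
  rw [hyT j hj] at hlt
  have hiT : i ∉ T := fun h => (hyT i h ▸ hlt).not_ge hi
  rw [hyS i hiT] at hlt
  have hd : (k.1 j).unbotD 0 - (k.2 i).unbotD 0 ∈ coefficientDifferences K :=
    Set.mem_biUnion hk ⟨(i, j), rfl⟩
  refine ⟨i, hiT, j, hj, _, hd, ?_⟩
  have hg := hgap _ (Set.mem_image2_of_mem hd (Set.mem_univ (i, j)))
  simp only [hu] at hg
  clear_value u y
  generalize homogenize 0 x i = p at *
  generalize homogenize 0 x j = q at *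
  generalize k.1 j = a at *
  generalize k.2 i = b at *
  -- `hlt` and `hi` force all four values to be finite, so the default in `unbotD` plays no role.
  induction a using WithBot.recBotCoe with
  | bot => simp at hlt
  | coe a =>
  induction q using WithBot.recBotCoe with
  | bot => simp at hlt
  | coe q =>
  induction b using WithBot.recBotCoe with
  | bot => simp [← WithBot.coe_add] at hi
  | coe b =>
  induction p using WithBot.recBotCoe with
  | bot => simp [← WithBot.coe_add] at hi
  | coe p =>
    simp only [WithBot.unbotD_coe] at hg ⊢
    norm_cast at hlt hi ⊢
    by_contra hne
    have hpos : 0 < p - q - (a - b) :=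
      lt_of_le_of_ne (by linarith) fun h => hne (by linarith)
    linarith [hg hpos]

/-- The values reachable from `0` and `⊥` by at most `m` translations by elements of `D`. -/
def reachableValues (D : Set ℝ) : ℕ → Set Rmax
  | 0 => {0, ⊥}
  | m + 1 => reachableValues D m ∪
      Set.image2 (fun (d : ℝ) (r : Rmax) => (d : Rmax) + r) D (reachableValues D m)

theorem finite_reachableValues {D : Set ℝ} (hD : D.Finite) (m : ℕ) :
    (reachableValues D m).Finite := by
  induction m with
  | zero => exact Set.toFinite {0, ⊥}
  | succ m ih => exact ih.union (hD.image2 _ ih)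

theorem zero_mem_reachableValues (D : Set ℝ) (m : ℕ) : 0 ∈ reachableValues D m := by
  induction m with
  | zero => exact Or.inl rfl
  | succ m ih => exact Or.inl ih

theorem bot_mem_reachableValues (D : Set ℝ) (m : ℕ) : ⊥ ∈ reachableValues D m := by
  induction m with
  | zero => exact Or.inr rfl
  | succ m ih => exact Or.inl ih

theorem homogenize_mem_reachableValues_of_minimal {n : ℕ}
    {K : Set ((Option (Fin n) → Rmax) × (Option (Fin n) → Rmax))} (hK : K.Finite)
    {x : Fin n → Rmax} (hx : x ∈ minimalPoints (homogeneousSolutions K)) (o : Option (Fin n)) :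
    homogenize 0 x o ∈ reachableValues (coefficientDifferences K) n := by
  set T : ℕ → Set (Option (Fin n)) := fun m =>
    homogenize 0 x ⁻¹' reachableValues (coefficientDifferences K) m
  have hnone : ∀ m, none ∈ T m := fun m => zero_mem_reachableValues _ m
  have hmono : ∀ m, T m ⊆ T (m + 1) := fun m => Set.preimage_mono Set.subset_union_left
  -- Coordinates equal to `⊥` lie in `T 0`, so any missing coordinate is finite and `T` grows
  -- strictly until full; there are `n + 1` coordinates, hence `n` steps suffice.
  have hcard : ∀ m, T m = Set.univ ∨ m + 1 ≤ (T m).ncard := by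
    intro m
    induction m with
    | zero => exact Or.inr ((Set.ncard_pos (Set.toFinite _)).2 ⟨none, hnone 0⟩)
    | succ m ih =>
      by_cases hm : T m = Set.univ
      · exact Or.inl (Set.univ_subset_iff.1 (hm ▸ hmono m))
      · right
        obtain ⟨o, ho⟩ := (Set.ne_univ_iff_exists_notMem _).1 hm
        have hex : ∃ i, some i ∉ T m ∧ x i ≠ ⊥ := by
          cases o with
          | none => exact absurd (hnone m) ho
          | some i =>
            refine ⟨i, ho, fun hbot => ho ?_⟩
            change x i ∈ reachableValues _ m
            rw [hbot]
            exact bot_mem_reachableValues _ m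
        obtain ⟨i, hi, j, hj, d, hd, heq⟩ := exists_eq_add_of_minimal hK hx (hnone m) hex
        have hi' : i ∈ T (m + 1) := Or.inr ⟨d, hd, _, hj, heq.symm⟩
        have hss : T m ⊂ T (m + 1) := ⟨hmono m, fun h => hi (h hi')⟩
        have := Set.ncard_lt_ncard hss (Set.toFinite _)
        have := ih.resolve_left hm
        omega
  have huniv : T n = Set.univ := (hcard n).elim id fun h =>
    Set.eq_of_subset_of_ncard_le (Set.subset_univ _) (by simpa [Set.ncard_univ] using h)
  exact huniv.ge (Set.mem_univ o)

theorem finite_minimalPoints {n : ℕ} {P : Set (Fin n → Rmax)} (hP : IsTropicalPolyhedron P) :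
    (minimalPoints P).Finite := by
  obtain ⟨K, hK, rfl⟩ := hP.exists_homogeneousSolutions
  exact (Set.Finite.pi' fun _ => finite_reachableValues (finite_coefficientDifferences hK) n).subset
    fun x hx i => homogenize_mem_reachableValues_of_minimal hK hx (some i)

theorem tropicalDot_mono {n : ℕ} (a : Fin n → Rmax) : Monotone (tropicalDot a) := fun _ _ h =>
  Finset.sup_mono_fun fun i _ => add_le_add_right (h i) (a i)

theorem mainTheorem3 (n : ℕ) (TP : Set (Fin n → Rmax)) (hTP : IsTropicalPolyhedron TP)
    (hne : TP.Nonempty) :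
    (minimalPoints TP).Finite ∧ (minimalPoints TP).Nonempty ∧
      IsMinEssential (minimalPoints TP) TP := by
  have hfin := finite_minimalPoints hTP
  have hnonempty : (minimalPoints TP).Nonempty := by
    obtain ⟨x, hx⟩ := hne
    obtain ⟨m, hm, -⟩ := exists_minimalPoints_le hTP hx
    exact ⟨m, hm⟩
  refine ⟨hfin, hnonempty, fun x hx => hx.1, fun x => ?_⟩
  obtain ⟨z, hz, hmin⟩ := Set.exists_min_image _ (tropicalDot x) hfin hnonempty
  refine ⟨z, hz, fun w hw => ?_⟩
  obtain ⟨m, hm, hle⟩ := exists_minimalPoints_le hTP hw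
  exact (hmin m hm).trans (tropicalDot_mono x hle)
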